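/- Let $(W,S)$ be a Coxeter system with $S$ finite ($W$ may be infinite), with length function $\ell$. Let $\bar S$ be the set of classes of elements of $S$ under conjugacy in $W$, write $\bar s$ for the class of $s\in S$, and let $\mathbb Z[\bar S]$ be the free abelian group with basis $\bar S$. Let $\Gamma$ be a totally ordered abelian group and $\varphi:\bar S\to\Gamma$ a map. Let $\mathbb Z[\Gamma]=\bigoplus_{\gamma\in\Gamma}\mathbb Z e^\gamma$ be the group ring, and let $\mathcal H=\mathcal H(W,S,\varphi)$ be the Hecke algebra: the free $\mathbb Z[\Gamma]$-module with basis $(T_w)_{w\in W}$ and the associative bilinear multiplication determined by $T_wT_{w'}=T_{ww'}$ if $\ell(ww')=\ell(w)+\ell(w')$ and $(T_s-e^{\varphi(\bar s)})(T_s+e^{-\varphi(\bar s)})=0$ for $s\in S$. Let $h\mapsto\overline h$ be the additive map on $\mathcal H$ with $\overline{e^\gamma T_w}=e^{-\gamma}T_{w^{-1}}^{-1}$. For $w\in W$ let $C_w$ be the unique element of $\mathcal H$ such that $\overline{C_w}=C_w$ and $C_w\in T_w+\bigoplus_{y\in W}\mathbb Z[\Gamma_{<0}]\,T_y$, where $\mathbb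 Z[\Gamma_{<0}]=\bigoplus_{\gamma<0}\mathbb Z e^\gamma$; the family $(C_w)_{w\in W}$ is a $\mathbb Z[\Gamma]$-basis of $\mathcal H$. For $x,y\in W$ write $x\leftarrow_L y$ (respectively $x\leftarrow_R y$, respectively $x\leftarrow_{LR}y$) if there is $h\in\mathcal H$ such that the coefficient of $C_x$ in the expansion, in this basis, of $hC_y$ (respectively of $C_yh$, respectively of $hC_y$ or of $C_yh$) is non-zero. For $?\in\{L,R,LR\}$ let $\leqslant_?^\varphi$ be the transitive closure of $\leftarrow_?$ and let $\sim_?^\varphi$ be the equivalence relation on $W$ associated with the preorder $\leqslant_?^\varphi$: $x\sim_?^\varphi y$ if and only if $x\leqslant_?^\varphi y$ and $y\leqslant_?^\varphi x$. A subset $X$ of $\mathbb Z[\bar S]$ is called positive if $\mathbb Z[\bar S]=X\cup(-X)$, $X+X\subseteq X$, and $X\cap(-X)$ is a subgroup. For such an $X$ put $\Gamma_X=\mathbb Z[\bar S]/(X\cap(-X))$, totally ordered by: $\gamma\leqslant_X\gamma'$ if and only if some representative of $\gamma'-\gamma$ lies in $X$. Let $\varphi_X:\bar S\to\Gamma_X$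 be the canonical map, and put ${\sim_?^X}={\sim_?^{\varphi_X}}$. For $\omega\in\bar S$ let $\tau_\omega$ be the automorphism of $\mathbb Z[\bar S]$ with $\tau_\omega(\omega)=-\omega$ and $\tau_\omega(\omega')=\omega'$ for $\omega'\in\bar S$, $\omega'\ne\omega$, and put $\tau_\omega^*(X)=\tau_\omega^{-1}(X)$, which is again a positive subset. **Proposition.** For every $\omega\in\bar S$, every positive subset $X$ of $\mathbb Z[\bar S]$ and every $?\in\{L,R,LR\}$, the relations $\sim_?^X$ and $\sim_?^{\tau_\omega^*(X)}$ on $W$ coincide. -/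

import Mathlib

namespace CoxeterSystem

/-! ### An exchange property -/

/-- The permutation-type operator attached to a simple reflection: it conjugates the first
coordinate and records in the second one whether the first coordinate is that reflection. -/
noncomputable def exchangeStep {B W : Type*} [Group W] {M : CoxeterMatrix B}
    (cs : CoxeterSystem M W) (i : B) : Function.End (W × ZMod 2) :=
  open Classical in
  fun p => (cs.simple i * p.1 * cs.simple i, p.2 + if p.1 = cs.simple i then 1 else 0)

theorem exchangeStep_prod {B W : Type*} [Group W] [DecidableEq W] {M : CoxeterMatrix B}
    (cs : CoxeterSystem M W) (l : List B) (p : W × ZMod 2) :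
    (l.map cs.exchangeStep).prod p =
      (cs.wordProd l * p.1 * (cs.wordProd l)⁻¹, p.2 + ((cs.rightInvSeq l).count p.1 : ZMod 2)) := by
  induction l with
  | nil => simp [rightInvSeq]; rfl
  | cons i l ih =>
    rw [List.map_cons, List.prod_cons]
    change cs.exchangeStep i ((l.map cs.exchangeStep).prod p) = _
    rw [ih]
    simp only [exchangeStep, rightInvSeq, List.count_cons, wordProd_cons, Prod.mk.injEq]
    refine ⟨by simp [mul_assoc], ?_⟩
    have h : (cs.wordProd l * p.1 * (cs.wordProd l)⁻¹ = cs.simple i) ↔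
        ((cs.wordProd l)⁻¹ * cs.simple i * cs.wordProd l == p.1) = true := by
      rw [beq_iff_eq]
      constructor
      · intro h; rw [← h]; group
      · intro h; rw [← h]; group
    by_cases h' : cs.wordProd l * p.1 * (cs.wordProd l)⁻¹ = cs.simple i
    · rw [if_pos h', if_pos (h.1 h')]; push_cast; ring
    · rw [if_neg h', if_neg (fun e => h' (h.2 e))]; push_cast; ring

theorem map_alternatingWord_prod {B G : Type*} [Monoid G] (f : B → G) (i j : B) (m : ℕ) :
    ((alternatingWord i j (2 * m)).map f).prod = (f i * f j) ^ m := by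
  induction m with
  | zero => simp [alternatingWord]
  | succ m ih =>
    rw [show 2 * (m + 1) = 2 * m + 1 + 1 by ring, alternatingWord_succ, alternatingWord_succ,
      pow_succ, ← ih]
    simp

theorem count_leftInvSeq_alternatingWord {B W : Type*} [Group W] [DecidableEq W]
    {M : CoxeterMatrix B} (cs : CoxeterSystem M W) (i j : B) (t : W) :
    Even ((cs.leftInvSeq (alternatingWord i j (2 * M i j))).count t) := by
  set L := cs.leftInvSeq (alternatingWord i j (2 * M i j)) with hL
  have hlen : L.length = 2 * M i j := by simp [hL]
  have hper : L.drop (M i j) = L.take (M i j) := by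
    apply List.ext_getElem
    · simp [hlen]; omega
    · intro k h1 h2
      rw [List.getElem_drop, List.getElem_take]
      have hk : k < M i j := by simp [hlen] at h2; omega
      rw [getElem_leftInvSeq_alternatingWord cs i j (M i j) _ (by omega),
        getElem_leftInvSeq_alternatingWord cs i j (M i j) _ (by omega)]
      rw [alternatingWord_succ, alternatingWord_succ, wordProd_concat, wordProd_concat]
      congr 1
      unfold wordProd
      rw [map_alternatingWord_prod, map_alternatingWord_prod, pow_add]
      simp
  rw [← List.take_append_drop (M i j) L, hper, List.count_append]
  exact ⟨_, rfl⟩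

theorem exchangeStep_isLiftable {B W : Type*} [Group W] {M : CoxeterMatrix B}
    (cs : CoxeterSystem M W) : M.IsLiftable cs.exchangeStep := by
  classical
  intro i j
  rw [← map_alternatingWord_prod]
  funext p
  rw [exchangeStep_prod]
  have h1 : cs.wordProd (alternatingWord i j (2 * M i j)) = 1 := by
    unfold wordProd
    rw [map_alternatingWord_prod]; simp
  have h2 : Even ((cs.rightInvSeq (alternatingWord i j (2 * M i j))).count p.1) := by
    have := cs.leftInvSeq_reverse (alternatingWord i j (2 * M i j)).reverse
    rw [List.reverse_reverse] at this
    have h3 : cs.rightInvSeq (alternatingWord i j (2 * M i j)) =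
        (cs.leftInvSeq (alternatingWord i j (2 * M i j)).reverse).reverse := by
      rw [cs.leftInvSeq_reverse, List.reverse_reverse]
    have h4 : (alternatingWord i j (2 * M i j)).reverse = alternatingWord j i (2 * M j i) := by
      rw [M.symmetric j i]
      generalize M i j = m
      apply List.ext_getElem
      · simp
      · intro k h1 h2
        simp only [List.length_reverse, length_alternatingWord] at h1
        rw [List.getElem_reverse]
        simp only [length_alternatingWord]
        rw [getElem_alternatingWord _ _ _ _ (by omega), getElem_alternatingWord _ _ _ _ (by omega)]
        grind
    rw [h3, List.count_reverse, h4]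
    exact count_leftInvSeq_alternatingWord cs j i p.1
  rw [h1]
  obtain ⟨r, hr⟩ := h2
  have : ((r + r : ℕ) : ZMod 2) = 0 := by
    push_cast; exact CharTwo.add_self_eq_zero _
  rw [hr, this]
  simp
  rfl

theorem count_rightInvSeq_eq {B W : Type*} [Group W] [DecidableEq W] {M : CoxeterMatrix B}
    (cs : CoxeterSystem M W) {l l' : List B} (h : cs.wordProd l = cs.wordProd l') (t : W) :
    ((cs.rightInvSeq l).count t : ZMod 2) = (cs.rightInvSeq l').count t := by
  have key : ∀ l : List B, cs.lift ⟨_, cs.exchangeStep_isLiftable⟩ (cs.wordProd l) =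
      (l.map cs.exchangeStep).prod := by
    intro l
    unfold wordProd
    rw [map_list_prod, List.map_map]
    congr 2
    funext i
    simp
  have h2 : (l.map cs.exchangeStep).prod (t, 0) = (l'.map cs.exchangeStep).prod (t, 0) := by
    rw [← key, ← key, h]
  rw [exchangeStep_prod, exchangeStep_prod] at h2
  simpa using congrArg Prod.snd h2

theorem mem_rightInvSeq_of_isRightDescent {B W : Type*} [Group W] {M : CoxeterMatrix B}
    (cs : CoxeterSystem M W) (l : List B) (i : B) (h : cs.IsRightDescent (cs.wordProd l) i) :
    cs.simple i ∈ cs.rightInvSeq l := by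
  classical
  obtain ⟨l', hl', hw⟩ := cs.exists_isReduced (cs.wordProd l * cs.simple i)
  have hprod : cs.wordProd (l'.concat i) = cs.wordProd l := by
    rw [wordProd_concat, ← hw]; simp
  have hred : cs.IsReduced (l'.concat i) := by
    have h1 := cs.isRightDescent_iff.1 h
    unfold IsReduced
    rw [hprod, List.length_concat, ← h1, hw, hl'.eq]
  have hnd := hred.nodup_rightInvSeq
  have hmem : cs.simple i ∈ cs.rightInvSeq (l'.concat i) := by
    rw [rightInvSeq_concat]; simp
  have h3 := cs.count_rightInvSeq_eq hprod (cs.simple i)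
  rw [List.count_eq_one_of_mem hnd hmem] at h3
  by_contra hn
  rw [List.count_eq_zero_of_not_mem hn] at h3
  simp at h3

theorem exchange_right {B W : Type*} [Group W] {M : CoxeterMatrix B}
    (cs : CoxeterSystem M W) (w : W) (i j : B) (h1 : ¬ cs.IsRightDescent w j)
    (h2 : cs.IsRightDescent (cs.simple i * w) j) : cs.simple i * w = w * cs.simple j := by
  obtain ⟨l, hl, rfl⟩ := cs.exists_isReduced w
  rw [← wordProd_cons] at h2
  have h := cs.mem_rightInvSeq_of_isRightDescent _ _ h2
  rw [rightInvSeq, List.mem_cons] at h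
  rcases h with h | h
  · rw [h]; group
  · exact absurd (cs.isRightInversion_of_mem_rightInvSeq hl h).2 h1

theorem isRightDescent_simple_mul_iff {B W : Type*} [Group W] {M : CoxeterMatrix B}
    (cs : CoxeterSystem M W) (w : W) (i j : B) (h : cs.simple i * w ≠ w * cs.simple j) :
    cs.IsRightDescent (cs.simple i * w) j ↔ cs.IsRightDescent w j := by
  constructor
  · intro h2
    by_contra h1
    exact h (cs.exchange_right w i j h1 h2)
  · intro h2
    by_contra h1
    have := cs.exchange_right (cs.simple i * w) i j h1 (by simpa using h2)
    apply h
    rw [simple_mul_simple_cancel_left] at this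
    conv_rhs => rw [this]
    simp

theorem isLeftDescent_mul_simple_iff {B W : Type*} [Group W] {M : CoxeterMatrix B}
    (cs : CoxeterSystem M W) (w : W) (i j : B) (h : cs.simple i * w ≠ w * cs.simple j) :
    cs.IsLeftDescent (w * cs.simple j) i ↔ cs.IsLeftDescent w i := by
  rw [← isRightDescent_inv_iff, ← isRightDescent_inv_iff, mul_inv_rev, inv_simple]
  apply isRightDescent_simple_mul_iff
  intro h'
  apply h
  have := congrArg (·⁻¹) h'
  simpa using this.symm

end CoxeterSystem

namespace CoxeterSystem

/-! ### Conjugacy classes of simple reflections -/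

/-- Two indices are equivalent when the simple reflections are conjugate in `W`. -/
def simpleConj {B W : Type*} [Group W] {M : CoxeterMatrix B} (cs : CoxeterSystem M W) :
    Setoid B where
  r i j := IsConj (cs.simple i) (cs.simple j)
  iseqv := ⟨fun _ => IsConj.refl _, fun h => h.symm, fun h h' => h.trans h'⟩

/-- The set of `W`-conjugacy classes of simple reflections. -/
def SBar {B W : Type*} [Group W] {M : CoxeterMatrix B} (cs : CoxeterSystem M W) : Type _ :=
  Quotient cs.simpleConj

/-- The class of a simple reflection. -/
def toSBar {B W : Type*} [Group W] {M : CoxeterMatrix B} (cs : CoxeterSystem M W) (i : B) :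
    cs.SBar :=
  Quotient.mk cs.simpleConj i

/-! ### The Hecke algebra with unequal parameters -/

/-- The underlying module of the Hecke algebra with parameter `φ`: the free module over
the group ring `ℤ[Γ]` on the set `W`. -/
def HeckeAlgebra {B W Γ : Type*} [Group W] {M : CoxeterMatrix B} (cs : CoxeterSystem M W)
    [AddCommGroup Γ] (_φ : cs.SBar → Γ) : Type _ :=
  W →₀ AddMonoidAlgebra ℤ Γ

namespace HeckeAlgebra

noncomputable section

variable {B W Γ : Type*} [Group W] {M : CoxeterMatrix B} {cs : CoxeterSystem M W}
  [AddCommGroup Γ] {φ : cs.SBar → Γ}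

instance : AddCommGroup (HeckeAlgebra cs φ) :=
  inferInstanceAs (AddCommGroup (W →₀ AddMonoidAlgebra ℤ Γ))

instance : Module (AddMonoidAlgebra ℤ Γ) (HeckeAlgebra cs φ) :=
  inferInstanceAs (Module (AddMonoidAlgebra ℤ Γ) (W →₀ AddMonoidAlgebra ℤ Γ))

variable (cs φ) in
/-- The standard basis `(T_w)`. -/
def basis : Module.Basis W (AddMonoidAlgebra ℤ Γ) (HeckeAlgebra cs φ) :=
  Module.Basis.ofRepr (LinearEquiv.refl _ (W →₀ AddMonoidAlgebra ℤ Γ))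

variable (cs φ) in
/-- The standard basis element `T_w`. -/
def T (w : W) : HeckeAlgebra cs φ := basis cs φ w

variable (cs φ) in
/-- The scalar `e^{φ(s)} - e^{-φ(s)}`. -/
def xi (i : B) : AddMonoidAlgebra ℤ Γ :=
  AddMonoidAlgebra.single (φ (cs.toSBar i)) 1 - AddMonoidAlgebra.single (-φ (cs.toSBar i)) 1

open Classical in
variable (cs φ) in
/-- Left multiplication by `T_s`. -/
def leftOp (i : B) : Module.End (AddMonoidAlgebra ℤ Γ) (HeckeAlgebra cs φ) :=
  (basis cs φ).constr (AddMonoidAlgebra ℤ Γ) fun w =>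
    T cs φ (cs.simple i * w) + if cs.IsLeftDescent w i then xi cs φ i • T cs φ w else 0

open Classical in
variable (cs φ) in
/-- Right multiplication by `T_s`. -/
def rightOp (i : B) : Module.End (AddMonoidAlgebra ℤ Γ) (HeckeAlgebra cs φ) :=
  (basis cs φ).constr (AddMonoidAlgebra ℤ Γ) fun w =>
    T cs φ (w * cs.simple i) + if cs.IsRightDescent w i then xi cs φ i • T cs φ w else 0

theorem leftOp_T (i : B) (w : W) [Decidable (cs.IsLeftDescent w i)] :
    leftOp cs φ i (T cs φ w) =
    T cs φ (cs.simple i * w) + if cs.IsLeftDescent w i then xi cs φ i • T cs φ w else 0 := by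
  rw [leftOp, T, Module.Basis.constr_basis]
  congr

theorem rightOp_T (i : B) (w : W) [Decidable (cs.IsRightDescent w i)] :
    rightOp cs φ i (T cs φ w) =
    T cs φ (w * cs.simple i) + if cs.IsRightDescent w i then xi cs φ i • T cs φ w else 0 := by
  rw [rightOp, T, Module.Basis.constr_basis]
  congr

theorem leftOp_comm_rightOp (i j : B) :
    leftOp cs φ i * rightOp cs φ j = rightOp cs φ j * leftOp cs φ i := by
  classical
  refine (basis cs φ).ext fun w => ?_
  change leftOp cs φ i (rightOp cs φ j (T cs φ w)) = rightOp cs φ j (leftOp cs φ i (T cs φ w))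
  rw [rightOp_T, leftOp_T, map_add, map_add, leftOp_T, rightOp_T, mul_assoc]
  by_cases h : cs.simple i * w = w * cs.simple j
  · have hx : xi cs φ i = xi cs φ j := by
      have : cs.toSBar i = cs.toSBar j := by
        refine Quotient.sound (s := cs.simpleConj) (IsConj.symm ?_)
        refine isConj_iff.2 ⟨w, ?_⟩
        rw [← h]; group
      rw [xi, xi, this]
    have hw : cs.simple i * (w * cs.simple j) = w := by rw [← h]; simp
    have h1 : cs.IsLeftDescent (w * cs.simple j) i ↔ cs.IsRightDescent (cs.simple i * w) j := by
      rw [IsLeftDescent, IsRightDescent, hw, mul_assoc, hw, h]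
    have h2 : cs.IsLeftDescent w i ↔ cs.IsRightDescent w j := by
      rw [IsLeftDescent, IsRightDescent, h]
    simp only [h1, h2, h, hx]
    split_ifs <;> simp only [map_smul, map_zero, leftOp_T, rightOp_T, h2, h, hx]
  · have h1 := cs.isLeftDescent_mul_simple_iff w i j h
    have h2 := cs.isRightDescent_simple_mul_iff w i j h
    simp only [h1, h2]
    split_ifs <;> simp only [map_smul, map_zero, leftOp_T, rightOp_T] <;>
      simp [*, smul_smul, mul_comm]; abel

variable (cs) in
/-- A chosen reduced expression of `w`. -/
def redWord (w : W) : List B := (cs.exists_isReduced w).choose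

theorem redWord_isReduced (w : W) : cs.IsReduced (redWord cs w) :=
  (cs.exists_isReduced w).choose_spec.1

theorem wordProd_redWord (w : W) : cs.wordProd (redWord cs w) = w :=
  (cs.exists_isReduced w).choose_spec.2.symm

variable (cs φ) in
/-- The bilinear multiplication: `T_w` acts on the left through the operators of a
reduced expression of `w`. -/
def mulLin : HeckeAlgebra cs φ →ₗ[AddMonoidAlgebra ℤ Γ]
    Module.End (AddMonoidAlgebra ℤ Γ) (HeckeAlgebra cs φ) :=
  (basis cs φ).constr (AddMonoidAlgebra ℤ Γ) fun w => ((redWord cs w).map (leftOp cs φ)).prod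

theorem mulLin_T (w : W) :
    mulLin cs φ (T cs φ w) = ((redWord cs w).map (leftOp cs φ)).prod := by
  rw [mulLin, T, Module.Basis.constr_basis]

theorem leftOp_prod_T_one (l : List B) (hl : cs.IsReduced l) :
    (l.map (leftOp cs φ)).prod (T cs φ 1) = T cs φ (cs.wordProd l) := by
  classical
  induction l with
  | nil => simp
  | cons i l ih =>
    have hl' : cs.IsReduced l := by simpa using hl.drop 1
    rw [List.map_cons, List.prod_cons, Module.End.mul_apply, ih hl', leftOp_T, if_neg, add_zero,
      wordProd_cons]
    rw [IsLeftDescent, ← wordProd_cons, hl.eq, hl'.eq]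
    simp

theorem rightOp_prod_T_one (l : List B) (hl : cs.IsReduced l) :
    (l.reverse.map (rightOp cs φ)).prod (T cs φ 1) = T cs φ (cs.wordProd l) := by
  classical
  induction l using List.reverseRecOn with
  | nil => simp
  | append_singleton l i ih =>
    have hl' : cs.IsReduced l := by simpa using hl.take l.length
    rw [List.reverse_append, List.reverse_singleton, List.singleton_append, List.map_cons,
      List.prod_cons, Module.End.mul_apply, ih hl', rightOp_T, if_neg, add_zero,
      ← wordProd_concat, List.concat_eq_append]
    rw [IsRightDescent, ← wordProd_concat, List.concat_eq_append, hl.eq, hl'.eq]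
    simp

theorem mulLin_T_apply_one (a : HeckeAlgebra cs φ) : mulLin cs φ a (T cs φ 1) = a := by
  have : (LinearMap.applyₗ (T cs φ 1)).comp (mulLin cs φ) = LinearMap.id := by
    refine (basis cs φ).ext fun w => ?_
    change mulLin cs φ (T cs φ w) (T cs φ 1) = T cs φ w
    rw [mulLin_T, leftOp_prod_T_one _ (redWord_isReduced w), wordProd_redWord]
  exact LinearMap.congr_fun this a

theorem eq_of_commute {f g : Module.End (AddMonoidAlgebra ℤ Γ) (HeckeAlgebra cs φ)}
    (hf : ∀ j, Commute f (rightOp cs φ j)) (hg : ∀ j, Commute g (rightOp cs φ j))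
    (h : f (T cs φ 1) = g (T cs φ 1)) : f = g := by
  have key : ∀ k : Module.End (AddMonoidAlgebra ℤ Γ) (HeckeAlgebra cs φ),
      (∀ j, Commute k (rightOp cs φ j)) → ∀ w, k (T cs φ w) =
        ((redWord cs w).reverse.map (rightOp cs φ)).prod (k (T cs φ 1)) := by
    intro k hk w
    have hc : Commute k ((redWord cs w).reverse.map (rightOp cs φ)).prod := by
      apply Commute.list_prod_right
      intro x hx
      obtain ⟨j, -, rfl⟩ := List.mem_map.1 hx
      exact hk j
    conv_lhs => rw [← wordProd_redWord (cs := cs) w,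
      ← rightOp_prod_T_one _ (redWord_isReduced w), ← Module.End.mul_apply, hc.eq]
    rfl
  refine (basis cs φ).ext fun w => ?_
  change f (T cs φ w) = g (T cs φ w)
  rw [key f hf, key g hg, h]

theorem mulLin_commute (a : HeckeAlgebra cs φ) (j : B) :
    Commute (mulLin cs φ a) (rightOp cs φ j) := by
  have : (LinearMap.mulRight (AddMonoidAlgebra ℤ Γ) (rightOp cs φ j)).comp (mulLin cs φ) =
      (LinearMap.mulLeft (AddMonoidAlgebra ℤ Γ) (rightOp cs φ j)).comp (mulLin cs φ) := by
    refine (basis cs φ).ext fun w => ?_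
    change mulLin cs φ (T cs φ w) * rightOp cs φ j = rightOp cs φ j * mulLin cs φ (T cs φ w)
    rw [mulLin_T]
    apply Commute.list_prod_left
    intro x hx
    obtain ⟨i, -, rfl⟩ := List.mem_map.1 hx
    exact leftOp_comm_rightOp i j
  exact LinearMap.congr_fun this a

theorem mulLin_mulLin (a b : HeckeAlgebra cs φ) :
    mulLin cs φ (mulLin cs φ a b) = mulLin cs φ a * mulLin cs φ b :=
  eq_of_commute (mulLin_commute _)
    (fun j => (mulLin_commute a j).mul_left (mulLin_commute b j)) (by
      rw [mulLin_T_apply_one, Module.End.mul_apply, mulLin_T_apply_one])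

theorem mulLin_T_one : mulLin cs φ (T cs φ 1) = 1 :=
  eq_of_commute (mulLin_commute _) (fun j => Commute.one_left _) (by
    rw [mulLin_T_apply_one]; rfl)

instance : Mul (HeckeAlgebra cs φ) := ⟨fun a b => mulLin cs φ a b⟩

instance : One (HeckeAlgebra cs φ) := ⟨T cs φ 1⟩

theorem mul_def (a b : HeckeAlgebra cs φ) : a * b = mulLin cs φ a b := rfl

theorem one_def : (1 : HeckeAlgebra cs φ) = T cs φ 1 := rfl

instance : Ring (HeckeAlgebra cs φ) where
  __ := (inferInstance : AddCommGroup (HeckeAlgebra cs φ))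
  left_distrib a b c := by simp only [mul_def, map_add]
  right_distrib a b c := by simp only [mul_def, map_add, LinearMap.add_apply]
  zero_mul a := by simp only [mul_def, map_zero, LinearMap.zero_apply]
  mul_zero a := by simp only [mul_def, map_zero]
  mul_assoc a b c := by simp only [mul_def, mulLin_mulLin, Module.End.mul_apply]
  one_mul a := by simp only [mul_def, one_def, mulLin_T_one, Module.End.one_apply]
  mul_one a := by simp only [mul_def, one_def, mulLin_T_apply_one]

instance : Algebra (AddMonoidAlgebra ℤ Γ) (HeckeAlgebra cs φ) :=
  Algebra.ofModule
    (fun r a b => by simp only [mul_def, map_smul, LinearMap.smul_apply])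
    (fun r a b => by simp only [mul_def, map_smul])

theorem mulLin_T_simple (i : B) : mulLin cs φ (T cs φ (cs.simple i)) = leftOp cs φ i :=
  eq_of_commute (mulLin_commute _) (leftOp_comm_rightOp i) (by
    classical
    rw [mulLin_T_apply_one, leftOp_T, if_neg (cs.not_isLeftDescent_one i), mul_one, add_zero])

theorem T_simple_mul_of_not_descent {i : B} {w : W} (h : ¬ cs.IsLeftDescent w i) :
    T cs φ (cs.simple i) * T cs φ w = T cs φ (cs.simple i * w) := by
  classical
  rw [mul_def, mulLin_T_simple, leftOp_T, if_neg h, add_zero]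

theorem T_simple_mul_of_descent {i : B} {w : W} (h : cs.IsLeftDescent w i) :
    T cs φ (cs.simple i) * T cs φ w = T cs φ (cs.simple i * w) + xi cs φ i • T cs φ w := by
  classical
  rw [mul_def, mulLin_T_simple, leftOp_T, if_pos h]

/-- First defining rule of the multiplication. -/
theorem T_mul_T (w w' : W) (h : cs.length (w * w') = cs.length w + cs.length w') :
    T cs φ w * T cs φ w' = T cs φ (w * w') := by
  obtain ⟨l, hl, rfl⟩ := cs.exists_isReduced w
  induction l with
  | nil => simp [← one_def]
  | cons i l ih =>
    have hl' : cs.IsReduced l := by simpa using hl.drop 1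
    have e := hl.eq
    have e' := hl'.eq
    rw [List.length_cons] at e
    rw [wordProd_cons] at h e ⊢
    have b1 := cs.length_mul_le (cs.wordProd l) w'
    have b2 := cs.length_mul_le (cs.simple i) (cs.wordProd l * w')
    rw [cs.length_simple, ← mul_assoc] at b2
    have n1 : ¬ cs.IsLeftDescent (cs.wordProd l) i := by rw [IsLeftDescent]; omega
    have n2 : ¬ cs.IsLeftDescent (cs.wordProd l * w') i := by
      rw [IsLeftDescent, ← mul_assoc]; omega
    rw [← T_simple_mul_of_not_descent n1, mul_assoc (T cs φ _), ih hl' (by omega),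
      T_simple_mul_of_not_descent n2, mul_assoc]

theorem T_simple_sq (i : B) : T cs φ (cs.simple i) * T cs φ (cs.simple i) =
    1 + xi cs φ i • T cs φ (cs.simple i) := by
  rw [T_simple_mul_of_descent, one_def]
  · simp
  · simp [IsLeftDescent]

/-- Second defining rule of the multiplication. -/
theorem quadratic (i : B) :
    (T cs φ (cs.simple i) - algebraMap _ _ (AddMonoidAlgebra.single (φ (cs.toSBar i)) (1 : ℤ))) *
    (T cs φ (cs.simple i) + algebraMap _ _ (AddMonoidAlgebra.single (-φ (cs.toSBar i)) (1 : ℤ)))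
      = 0 := by
  have h : algebraMap (AddMonoidAlgebra ℤ Γ) (HeckeAlgebra cs φ)
        (AddMonoidAlgebra.single (φ (cs.toSBar i)) (1 : ℤ)) *
      algebraMap _ _ (AddMonoidAlgebra.single (-φ (cs.toSBar i)) (1 : ℤ)) = 1 := by
    rw [← map_mul, AddMonoidAlgebra.single_mul_single, add_neg_cancel, mul_one,
      ← AddMonoidAlgebra.one_def, map_one]
  rw [sub_mul, mul_add, mul_add, h, T_simple_sq, Algebra.smul_def, xi, map_sub, sub_mul,
    ← Algebra.commutes (AddMonoidAlgebra.single (-φ (cs.toSBar i)) (1 : ℤ))]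
  abel

end

end HeckeAlgebra

end CoxeterSystem

namespace CoxeterSystem

namespace HeckeAlgebra

noncomputable section

variable {B W Γ : Type*} [Group W] {M : CoxeterMatrix B} {cs : CoxeterSystem M W}
  [AddCommGroup Γ] {φ : cs.SBar → Γ}

/-! ### The bar involution -/

theorem T_simple_mul_inv (i : B) :
    T cs φ (cs.simple i) * (T cs φ (cs.simple i) - algebraMap _ _ (xi cs φ i)) = 1 := by
  rw [mul_sub, T_simple_sq, Algebra.smul_def, Algebra.commutes, add_sub_cancel_right]

theorem T_simple_inv_mul (i : B) :
    (T cs φ (cs.simple i) - algebraMap _ _ (xi cs φ i)) * T cs φ (cs.simple i) = 1 := by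
  rw [sub_mul, T_simple_sq, Algebra.smul_def, add_sub_cancel_right]

theorem isUnit_T_simple (i : B) : IsUnit (T cs φ (cs.simple i)) :=
  ⟨⟨_, _, T_simple_mul_inv i, T_simple_inv_mul i⟩, rfl⟩

theorem inverse_T_simple (i : B) :
    Ring.inverse (T cs φ (cs.simple i)) = T cs φ (cs.simple i) - algebraMap _ _ (xi cs φ i) :=
  Ring.inverse_unit (⟨_, _, T_simple_mul_inv i, T_simple_inv_mul i⟩ : (HeckeAlgebra cs φ)ˣ)

theorem isUnit_T (w : W) : IsUnit (T cs φ w) := by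
  obtain ⟨l, hl, rfl⟩ := cs.exists_isReduced w
  induction l with
  | nil => rw [wordProd_nil, ← one_def]; exact isUnit_one
  | cons i l ih =>
    have hl' : cs.IsReduced l := by simpa using hl.drop 1
    rw [wordProd_cons, ← T_simple_mul_of_not_descent]
    · exact (isUnit_T_simple i).mul (ih hl')
    · rw [IsLeftDescent, ← wordProd_cons, hl.eq, hl'.eq]
      simp

variable (Γ) in
/-- The involution `e^γ ↦ e^{-γ}` of the group ring. -/
def barCoeff : AddMonoidAlgebra ℤ Γ →+* AddMonoidAlgebra ℤ Γ :=
  AddMonoidAlgebra.mapDomainRingHom ℤ (negAddMonoidHom : Γ →+ Γ)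

theorem barCoeff_single (γ : Γ) (n : ℤ) :
    barCoeff Γ (AddMonoidAlgebra.single γ n) = AddMonoidAlgebra.single (-γ) n := by
  simp [barCoeff]

theorem coeff_barCoeff (a : AddMonoidAlgebra ℤ Γ) (γ : Γ) :
    (barCoeff Γ a).coeff γ = a.coeff (-γ) := by
  induction a using AddMonoidAlgebra.induction_linear with
  | zero => simp
  | add a b ha hb => simp [ha, hb]
  | single δ n =>
    classical
    rw [barCoeff_single]
    simp [Finsupp.single_apply, neg_eq_iff_eq_neg]

variable (cs φ) in
/-- The bar involution: the antilinear map sending `T_w` to `(T_{w⁻¹})⁻¹`. -/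
def bar : HeckeAlgebra cs φ →ₛₗ[barCoeff Γ] HeckeAlgebra cs φ where
  toFun h := ((basis cs φ).repr h).sum fun w a => barCoeff Γ a • Ring.inverse (T cs φ w⁻¹)
  map_add' a b := by
    rw [map_add]
    exact Finsupp.sum_add_index' (by simp) (by simp [add_smul])
  map_smul' r a := by
    rw [map_smul, Finsupp.sum_smul_index (by simp), Finsupp.smul_sum]
    simp [mul_smul]

theorem bar_T (w : W) : bar cs φ (T cs φ w) = Ring.inverse (T cs φ w⁻¹) := by
  change ((basis cs φ).repr (T cs φ w)).sum
    (fun w a => barCoeff Γ a • Ring.inverse (T cs φ w⁻¹)) = _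
  rw [T, Module.Basis.repr_self, Finsupp.sum_single_index (by simp)]
  simp

theorem bar_one : bar cs φ 1 = 1 := by
  rw [one_def, bar_T, inv_one, ← one_def, Ring.inverse_one]

theorem bar_T_simple_mul_T_of_not_descent {i : B} {w : W} (h : ¬ cs.IsLeftDescent w i) :
    bar cs φ (T cs φ (cs.simple i * w)) =
      (T cs φ (cs.simple i) - algebraMap _ _ (xi cs φ i)) * bar cs φ (T cs φ w) := by
  rw [bar_T, bar_T, mul_inv_rev, inv_simple, ← T_mul_T w⁻¹ (cs.simple i), ← inverse_T_simple]
  · obtain ⟨u, hu⟩ := isUnit_T (φ := φ) w⁻¹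
    obtain ⟨v, hv⟩ := isUnit_T_simple (φ := φ) i
    rw [← hu, ← hv, ← Units.val_mul, Ring.inverse_unit, Ring.inverse_unit, Ring.inverse_unit,
      mul_inv_rev, Units.val_mul]
  · rw [cs.length_simple, cs.length_inv, ← cs.not_isLeftDescent_iff.1 h, ← cs.length_inv,
      mul_inv_rev, inv_inv, inv_simple]

theorem barCoeff_xi (i : B) : barCoeff Γ (xi cs φ i) = - xi cs φ i := by
  rw [xi, map_sub, barCoeff_single, barCoeff_single, neg_neg, neg_sub]

theorem bar_T_simple_mul (i : B) (h : HeckeAlgebra cs φ) :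
    bar cs φ (T cs φ (cs.simple i) * h) =
      (T cs φ (cs.simple i) - algebraMap _ _ (xi cs φ i)) * bar cs φ h := by
  have key : (bar cs φ).comp (LinearMap.mulLeft (AddMonoidAlgebra ℤ Γ) (T cs φ (cs.simple i))) =
      (LinearMap.mulLeft (AddMonoidAlgebra ℤ Γ)
        (T cs φ (cs.simple i) - algebraMap _ _ (xi cs φ i))).comp (bar cs φ) := by
    refine (basis cs φ).ext fun w => ?_
    change bar cs φ (T cs φ (cs.simple i) * T cs φ w) = _ * bar cs φ (T cs φ w)
    by_cases hd : cs.IsLeftDescent w i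
    · have hd' : ¬ cs.IsLeftDescent (cs.simple i * w) i :=
        cs.isLeftDescent_iff_not_isLeftDescent_mul.1 hd
      have e := bar_T_simple_mul_T_of_not_descent (φ := φ) hd'
      rw [simple_mul_simple_cancel_left] at e
      rw [T_simple_mul_of_descent hd, map_add, LinearMap.map_smulₛₗ, barCoeff_xi, e, ← mul_assoc,
        Algebra.smul_def, ← mul_assoc]
      set t := T cs φ (cs.simple i)
      set x := algebraMap (AddMonoidAlgebra ℤ Γ) (HeckeAlgebra cs φ) (xi cs φ i) with hx
      have h1 : t * t = 1 + x * t := by rw [T_simple_sq, Algebra.smul_def]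
      have h2 : t * x = x * t := (Algebra.commutes _ _).symm
      rw [map_neg, ← hx]
      conv_lhs => enter [1]; rw [← one_mul (bar cs φ (T cs φ (cs.simple i * w)))]
      rw [← add_mul]
      congr 1
      rw [sub_mul, mul_sub, mul_sub, h1, h2]
      noncomm_ring
    · rw [T_simple_mul_of_not_descent hd, bar_T_simple_mul_T_of_not_descent hd]
  exact LinearMap.congr_fun key h

/-! ### The length filtration -/

variable (cs φ) in
/-- The span of the `T_y` with `y` of length smaller than `n`. -/
def low (n : ℕ) : Submodule (AddMonoidAlgebra ℤ Γ) (HeckeAlgebra cs φ) where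
  carrier := {h | ∀ y, n ≤ cs.length y → (basis cs φ).repr h y = 0}
  add_mem' ha hb y hy := by simp [ha y hy, hb y hy]
  zero_mem' y _ := by simp
  smul_mem' r a ha y hy := by simp [ha y hy]

theorem repr_T [DecidableEq W] (w y : W) :
    (basis cs φ).repr (T cs φ w) y = if w = y then 1 else 0 := by
  rw [T, Module.Basis.repr_self, Finsupp.single_apply]

theorem T_mem_low {w : W} {n : ℕ} (h : cs.length w < n) : T cs φ w ∈ low cs φ n := by
  classical
  intro y hy
  rw [repr_T, if_neg]
  rintro rfl
  omega

theorem low_mono {m n : ℕ} (h : m ≤ n) : low cs φ m ≤ low cs φ n :=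
  fun _ ha y hy => ha y (h.trans hy)

theorem mem_of_T_mem {n : ℕ} {h : HeckeAlgebra cs φ} (hh : h ∈ low cs φ n)
    {N : Submodule (AddMonoidAlgebra ℤ Γ) (HeckeAlgebra cs φ)}
    (f : Module.End (AddMonoidAlgebra ℤ Γ) (HeckeAlgebra cs φ))
    (hN : ∀ y, cs.length y < n → f (T cs φ y) ∈ N) : f h ∈ N := by
  rw [← (basis cs φ).linearCombination_repr h, Finsupp.linearCombination_apply, Finsupp.sum,
    map_sum]
  refine Submodule.sum_mem _ fun y hy => ?_
  rw [map_smul]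
  refine Submodule.smul_mem _ _ (hN y ?_)
  by_contra hlt
  exact Finsupp.mem_support_iff.1 hy (hh y (by omega))

theorem T_simple_mul_mem_low {n : ℕ} (i : B) {h : HeckeAlgebra cs φ} (hh : h ∈ low cs φ n) :
    T cs φ (cs.simple i) * h ∈ low cs φ (n + 1) := by
  refine mem_of_T_mem hh (LinearMap.mulLeft (AddMonoidAlgebra ℤ Γ) (T cs φ (cs.simple i))) ?_
  intro y hy
  rw [LinearMap.mulLeft_apply]
  by_cases hd : cs.IsLeftDescent y i
  · rw [T_simple_mul_of_descent hd]
    have : cs.length (cs.simple i * y) < cs.length y := hd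
    exact Submodule.add_mem _ (T_mem_low (by omega)) (Submodule.smul_mem _ _ (T_mem_low (by omega)))
  · rw [T_simple_mul_of_not_descent hd]
    have := cs.not_isLeftDescent_iff.1 hd
    exact T_mem_low (by omega)

theorem bar_T_sub_mem_low (w : W) :
    bar cs φ (T cs φ w) - T cs φ w ∈ low cs φ (cs.length w) := by
  obtain ⟨l, hl, rfl⟩ := cs.exists_isReduced w
  induction l with
  | nil => rw [wordProd_nil, ← one_def, bar_one, sub_self]; exact Submodule.zero_mem _
  | cons i l ih =>
    have hl' : cs.IsReduced l := by simpa using hl.drop 1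
    have hd : ¬ cs.IsLeftDescent (cs.wordProd l) i := by
      rw [IsLeftDescent, ← wordProd_cons, hl.eq, hl'.eq]
      simp
    have hlen := cs.not_isLeftDescent_iff.1 hd
    rw [wordProd_cons, ← T_simple_mul_of_not_descent hd, bar_T_simple_mul, sub_mul, hlen]
    set t := T cs φ (cs.wordProd l)
    have hb : bar cs φ t ∈ low cs φ (cs.length (cs.wordProd l) + 1) := by
      rw [← sub_add_cancel (bar cs φ t) t]
      exact Submodule.add_mem _ (low_mono (by omega) (ih hl')) (T_mem_low (by omega))
    have : T cs φ (cs.simple i) * bar cs φ t - algebraMap _ _ (xi cs φ i) * bar cs φ t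
        - T cs φ (cs.simple i) * t =
        T cs φ (cs.simple i) * (bar cs φ t - t) - xi cs φ i • bar cs φ t := by
      rw [Algebra.smul_def, mul_sub]; abel
    rw [this]
    exact Submodule.sub_mem _ (T_simple_mul_mem_low i (ih hl')) (Submodule.smul_mem _ _ hb)

/-! ### The Kazhdan-Lusztig basis -/

variable [LinearOrder Γ]

variable (Γ) in
/-- The subgroup `ℤ[Γ_{<0}]` of the group ring. -/
def negCoeff : AddSubgroup (AddMonoidAlgebra ℤ Γ) where
  carrier := {a | ∀ γ, a.coeff γ ≠ 0 → γ < 0}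
  add_mem' {a b} ha hb γ h := by
    by_cases h' : a.coeff γ = 0
    · exact hb γ (by simpa [h'] using h)
    · exact ha γ h'
  zero_mem' γ h := by simp at h
  neg_mem' {a} ha γ h := ha γ (by simpa using h)

variable (cs φ) in
/-- The subgroup `⨁_w ℤ[Γ_{<0}] T_w` of the Hecke algebra. -/
def negPart : AddSubgroup (HeckeAlgebra cs φ) where
  carrier := {h | ∀ w, (basis cs φ).repr h w ∈ negCoeff Γ}
  add_mem' ha hb w := by simpa using add_mem (ha w) (hb w)
  zero_mem' w := by simp [zero_mem]
  neg_mem' ha w := by simpa using ha w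

/-- The characterization of the Kazhdan-Lusztig element `C_w`: it is invariant under the bar
involution and congruent to `T_w` modulo `⨁_y ℤ[Γ_{<0}] T_y`. -/
def IsKL (w : W) (C : HeckeAlgebra cs φ) : Prop :=
  bar cs φ C = C ∧ C - T cs φ w ∈ negPart cs φ

variable [IsOrderedAddMonoid Γ]

theorem exists_bar_invariant_approx (a : AddMonoidAlgebra ℤ Γ) :
    ∃ s, barCoeff Γ s = s ∧ a - s ∈ negCoeff Γ := by
  induction a using AddMonoidAlgebra.induction_linear with
  | zero => exact ⟨0, by simp, by simp [zero_mem]⟩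
  | add a b ha hb =>
    obtain ⟨s, hs, has⟩ := ha
    obtain ⟨t, ht, hbt⟩ := hb
    exact ⟨s + t, by rw [map_add, hs, ht], by rw [add_sub_add_comm]; exact add_mem has hbt⟩
  | single δ n =>
    classical
    rcases lt_trichotomy δ 0 with h | rfl | h
    · refine ⟨0, by simp, ?_⟩
      intro γ hγ
      rw [sub_zero, AddMonoidAlgebra.coeff_single, Finsupp.single_apply] at hγ
      by_cases e : δ = γ
      · exact e ▸ h
      · simp [e] at hγ
    · exact ⟨.single 0 n, by rw [barCoeff_single, neg_zero], by simp [zero_mem]⟩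
    · refine ⟨.single δ n + .single (-δ) n, ?_, ?_⟩
      · rw [map_add, barCoeff_single, barCoeff_single, neg_neg, add_comm]
      · rw [sub_add_cancel_left]
        refine neg_mem ?_
        intro γ hγ
        rw [AddMonoidAlgebra.coeff_single, Finsupp.single_apply] at hγ
        by_cases e : -δ = γ
        · rw [← e]; simpa using h
        · simp [e] at hγ

theorem eq_zero_of_bar_invariant_of_neg {a : AddMonoidAlgebra ℤ Γ} (h : barCoeff Γ a = a)
    (ha : a ∈ negCoeff Γ) : a = 0 := by
  ext γ
  by_contra hne
  have h1 : γ < 0 := ha γ hne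
  have h2 : -γ < 0 := ha (-γ) (by rw [← coeff_barCoeff, h]; exact hne)
  exact lt_asymm h1 (by simpa using h2)

theorem eq_zero_of_bar_eq_of_mem_negPart {h : HeckeAlgebra cs φ} (hb : bar cs φ h = h)
    (hn : h ∈ negPart cs φ) : h = 0 := by
  classical
  by_contra h0
  have hs : ((basis cs φ).repr h).support.Nonempty := by
    rw [Finsupp.support_nonempty_iff]
    simpa using h0
  obtain ⟨y, hy, hmax⟩ := Finset.exists_max_image _ cs.length hs
  have h1 : (basis cs φ).repr (bar cs φ h) y = barCoeff Γ ((basis cs φ).repr h y) := by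
    change (basis cs φ).repr (Finsupp.sum _ _) y = _
    rw [Finsupp.sum, map_sum, Finsupp.finsetSum_apply, Finset.sum_eq_single y]
    · rw [← bar_T, ← sub_add_cancel (bar cs φ (T cs φ y)) (T cs φ y), smul_add, map_add,
        Finsupp.add_apply, map_smul, map_smul, Finsupp.smul_apply, Finsupp.smul_apply,
        bar_T_sub_mem_low y y le_rfl, repr_T]
      simp
    · intro x hx hxy
      rw [← bar_T, ← sub_add_cancel (bar cs φ (T cs φ x)) (T cs φ x), smul_add, map_add,
        Finsupp.add_apply, map_smul, map_smul, Finsupp.smul_apply, Finsupp.smul_apply,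
        bar_T_sub_mem_low x y (hmax x hx), repr_T]
      simp [hxy]
    · intro hy'
      exact absurd hy hy'
  rw [hb] at h1
  exact Finsupp.mem_support_iff.1 hy (eq_zero_of_bar_invariant_of_neg h1.symm (hn y))

theorem IsKL.unique {w : W} {C C' : HeckeAlgebra cs φ} (h : IsKL w C) (h' : IsKL w C') :
    C = C' := by
  rw [← sub_eq_zero]
  refine eq_zero_of_bar_eq_of_mem_negPart (by rw [map_sub, h.1, h'.1]) ?_
  simpa using sub_mem h.2 h'.2

theorem exists_correction (w : W) (n : ℕ)
    (ih : ∀ y, cs.length y < n →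
      ∃ C : HeckeAlgebra cs φ, IsKL y C ∧ C - T cs φ y ∈ low cs φ (cs.length y))
    (h : HeckeAlgebra cs φ) (hb : bar cs φ h = h) (hl : h - T cs φ w ∈ low cs φ n) :
    ∃ C : HeckeAlgebra cs φ, IsKL w C ∧ C - T cs φ w ∈ low cs φ n := by
  classical
  choose! C hC hClow using ih
  choose s hs hsn using exists_bar_invariant_approx (Γ := Γ)
  have step : ∀ j ≤ n, ∃ g : HeckeAlgebra cs φ, bar cs φ g = g ∧ g - T cs φ w ∈ low cs φ n ∧
      ∀ y, n ≤ cs.length y + j → (basis cs φ).repr (g - T cs φ w) y ∈ negCoeff Γ := by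
    intro j
    induction j with
    | zero =>
      intro _
      refine ⟨h, hb, hl, fun y hy => ?_⟩
      rw [hl y (by simpa using hy)]
      exact zero_mem _
    | succ j ihj =>
      intro hj
      obtain ⟨g, hg, hgl, hgn⟩ := ihj (by omega)
      set a := (basis cs φ).repr (g - T cs φ w) with ha
      set F := a.support.filter (fun y => cs.length y + j + 1 = n) with hF
      set D := ∑ y ∈ F, s (a y) • C y with hD
      have hFn : ∀ y ∈ F, cs.length y + j + 1 = n := fun y hy => (Finset.mem_filter.1 hy).2
      have hDb : bar cs φ D = D := by
        rw [hD, map_sum]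
        refine Finset.sum_congr rfl fun y hy => ?_
        rw [LinearMap.map_smulₛₗ, hs, (hC y (by have := hFn y hy; omega)).1]
      have hDr : ∀ y, n ≤ cs.length y + (j + 1) →
          (basis cs φ).repr D y = if y ∈ F then s (a y) else 0 := by
        intro y hy
        rw [hD, map_sum, Finsupp.finsetSum_apply, ← Finset.sum_ite_eq' F y (fun y => s (a y))]
        refine Finset.sum_congr rfl fun x hx => ?_
        have hxn := hFn x hx
        rw [← sub_add_cancel (C x) (T cs φ x), smul_add, map_add, Finsupp.add_apply, map_smul,
          map_smul, Finsupp.smul_apply, Finsupp.smul_apply,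
          hClow x (by omega) y (by omega), repr_T]
        simp
      have hDl : D ∈ low cs φ n := by
        refine Submodule.sum_mem _ fun x hx => Submodule.smul_mem _ _ ?_
        have hxn := hFn x hx
        rw [← sub_add_cancel (C x) (T cs φ x)]
        exact Submodule.add_mem _ (low_mono (by omega) (hClow x (by omega)))
          (T_mem_low (by omega))
      refine ⟨g - D, by rw [map_sub, hg, hDb], ?_, fun y hy => ?_⟩
      · rw [sub_right_comm]
        exact Submodule.sub_mem _ hgl hDl
      · rw [sub_right_comm, map_sub, Finsupp.sub_apply, ← ha, hDr y hy]
        by_cases hyF : y ∈ F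
        · rw [if_pos hyF]
          exact hsn _
        · rw [if_neg hyF, sub_zero]
          by_cases hyn : cs.length y + j + 1 = n
          · have : a y = 0 := by
              by_contra h0
              exact hyF (Finset.mem_filter.2 ⟨Finsupp.mem_support_iff.2 h0, hyn⟩)
            rw [this]; exact zero_mem _
          · exact hgn y (by omega)
  obtain ⟨g, hg, hgl, hgn⟩ := step n le_rfl
  exact ⟨g, ⟨hg, fun y => hgn y (by omega)⟩, hgl⟩

theorem exists_isKL (w : W) : ∃ C : HeckeAlgebra cs φ,
    IsKL w C ∧ C - T cs φ w ∈ low cs φ (cs.length w) := by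
  induction hn : cs.length w using Nat.strong_induction_on generalizing w with
  | _ n ih =>
    subst hn
    have ih' : ∀ y, cs.length y < cs.length w →
      ∃ C : HeckeAlgebra cs φ, IsKL y C ∧ C - T cs φ y ∈ low cs φ (cs.length y) :=
      fun y hy => ih _ hy y rfl
    by_cases hw : w = 1
    · subst hw
      refine exists_correction 1 _ ih' 1 bar_one ?_
      rw [← one_def, sub_self]; exact Submodule.zero_mem _
    · obtain ⟨i, hi⟩ := cs.exists_leftDescent_of_ne_one hw
      obtain ⟨C, hC, hCl⟩ := ih' (cs.simple i * w) hi
      have hd : ¬ cs.IsLeftDescent (cs.simple i * w) i :=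
        cs.isLeftDescent_iff_not_isLeftDescent_mul.1 hi
      have hlen := cs.isLeftDescent_iff.1 hi
      set c : AddMonoidAlgebra ℤ Γ := AddMonoidAlgebra.single (-φ (cs.toSBar i)) 1 with hc
      refine exists_correction w _ ih' (T cs φ (cs.simple i) * C + c • C) ?_ ?_
      · rw [map_add, bar_T_simple_mul, LinearMap.map_smulₛₗ, hC.1, sub_mul, ← Algebra.smul_def,
          sub_add, ← sub_smul, hc, barCoeff_single, neg_neg, xi, sub_sub_cancel_left, neg_smul,
          sub_neg_eq_add]
      · have hCm : C ∈ low cs φ (cs.length w) := by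
          rw [← sub_add_cancel C (T cs φ (cs.simple i * w))]
          exact Submodule.add_mem _ (low_mono (by omega) hCl) (T_mem_low (by omega))
        have e : T cs φ (cs.simple i) * C + c • C - T cs φ w =
            T cs φ (cs.simple i) * (C - T cs φ (cs.simple i * w)) + c • C := by
          rw [mul_sub, T_simple_mul_of_not_descent hd, simple_mul_simple_cancel_left]; abel
        rw [e]
        have h1 := T_simple_mul_mem_low i hCl
        rw [hlen] at h1
        exact Submodule.add_mem _ h1 (Submodule.smul_mem _ _ hCm)

theorem existsUnique_isKL (w : W) : ∃! C : HeckeAlgebra cs φ, IsKL w C := by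
  obtain ⟨C, hC, -⟩ := exists_isKL (φ := φ) w
  exact ⟨C, hC, fun _ h => h.unique hC⟩

variable (cs φ) in
/-- The Kazhdan-Lusztig element `C_w`. -/
def klElement (w : W) : HeckeAlgebra cs φ := (existsUnique_isKL w).choose

theorem klElement_isKL (w : W) : IsKL w (klElement cs φ w) :=
  (existsUnique_isKL w).choose_spec.1

theorem klElement_sub_mem_low (w : W) :
    klElement cs φ w - T cs φ w ∈ low cs φ (cs.length w) := by
  obtain ⟨C, hC, hl⟩ := exists_isKL (φ := φ) w
  rwa [(klElement_isKL w).unique hC]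

theorem repr_klElement [DecidableEq W] {w y : W} (h : cs.length w ≤ cs.length y) :
    (basis cs φ).repr (klElement cs φ w) y = if w = y then 1 else 0 := by
  rw [← sub_add_cancel (klElement cs φ w) (T cs φ w), map_add, Finsupp.add_apply,
    klElement_sub_mem_low w y h, repr_T, zero_add]

theorem klElement_linearIndependent :
    LinearIndependent (AddMonoidAlgebra ℤ Γ) (klElement cs φ) := by
  classical
  rw [linearIndependent_iff]
  intro c hc
  by_contra h0
  obtain ⟨y, hy, hmax⟩ := Finset.exists_max_image _ cs.length (Finsupp.support_nonempty_iff.2 h0)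
  have h1 := DFunLike.congr_fun (congrArg (basis cs φ).repr hc) y
  rw [Finsupp.linearCombination_apply, Finsupp.sum, map_sum, Finsupp.finsetSum_apply,
    Finset.sum_eq_single y] at h1
  · rw [map_smul, Finsupp.smul_apply, repr_klElement le_rfl] at h1
    exact Finsupp.mem_support_iff.1 hy (by simpa using h1)
  · intro x hx hxy
    rw [map_smul, Finsupp.smul_apply, repr_klElement (hmax x hx), if_neg hxy, smul_zero]
  · intro hy'
    exact absurd hy hy'

theorem klElement_span :
    ⊤ ≤ Submodule.span (AddMonoidAlgebra ℤ Γ) (Set.range (klElement cs φ)) := by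
  have key : ∀ n, ∀ w, cs.length w = n →
      T cs φ w ∈ Submodule.span (AddMonoidAlgebra ℤ Γ) (Set.range (klElement cs φ)) := by
    intro n
    induction n using Nat.strong_induction_on with
    | _ n ih =>
      rintro w rfl
      rw [← sub_sub_cancel (klElement cs φ w) (T cs φ w)]
      refine Submodule.sub_mem _ (Submodule.subset_span ⟨w, rfl⟩) ?_
      exact mem_of_T_mem (klElement_sub_mem_low w) LinearMap.id fun y hy => ih _ hy y rfl
  rw [← (basis cs φ).span_eq, Submodule.span_le]
  rintro _ ⟨w, rfl⟩
  exact key _ w rfl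

variable (cs φ) in
/-- The Kazhdan-Lusztig basis `(C_w)`. -/
def klBasis : Module.Basis W (AddMonoidAlgebra ℤ Γ) (HeckeAlgebra cs φ) :=
  Module.Basis.mk klElement_linearIndependent klElement_span

theorem klBasis_apply (w : W) : klBasis cs φ w = klElement cs φ w := by
  simp [klBasis]

end

end HeckeAlgebra

end CoxeterSystem

/-! ### Positive subsets of an abelian group -/

/-- A positive subset `X` of an abelian group `Λ`: `Λ = X ∪ (-X)`, `X + X ⊆ X`, and
`X ∩ (-X)` is a subgroup. -/
@[ext]
structure PositiveSubset (Λ : Type*) [AddCommGroup Λ] where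
  /-- The underlying set. -/
  carrier : Set Λ
  mem_or_neg_mem : ∀ a, a ∈ carrier ∨ -a ∈ carrier
  add_mem : ∀ a b, a ∈ carrier → b ∈ carrier → a + b ∈ carrier
  inter_neg_isSubgroup : ∃ K : AddSubgroup Λ, ∀ a, a ∈ K ↔ a ∈ carrier ∧ -a ∈ carrier

namespace PositiveSubset

noncomputable section

variable {Λ : Type*} [AddCommGroup Λ]

/-- The subgroup `X ∩ (-X)`. -/
def kernel (X : PositiveSubset Λ) : AddSubgroup Λ where
  carrier := {a | a ∈ X.carrier ∧ -a ∈ X.carrier}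
  add_mem' {a b} ha hb :=
    ⟨X.add_mem _ _ ha.1 hb.1, by rw [neg_add]; exact X.add_mem _ _ ha.2 hb.2⟩
  zero_mem' := by
    have h : (0 : Λ) ∈ X.carrier := by simpa using X.mem_or_neg_mem 0
    exact ⟨h, by simpa using h⟩
  neg_mem' {a} ha := ⟨ha.2, by simpa using ha.1⟩

theorem mem_kernel (X : PositiveSubset Λ) (a : Λ) :
    a ∈ X.kernel ↔ a ∈ X.carrier ∧ -a ∈ X.carrier := Iff.rfl

/-- The quotient group `Γ_X = Λ / (X ∩ (-X))`. -/
def ValueGroup (X : PositiveSubset Λ) : Type _ := Λ ⧸ X.kernel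

instance (X : PositiveSubset Λ) : AddCommGroup X.ValueGroup :=
  inferInstanceAs (AddCommGroup (Λ ⧸ X.kernel))

/-- The canonical morphism `Λ → Γ_X`. -/
def can (X : PositiveSubset Λ) : Λ →+ X.ValueGroup := QuotientAddGroup.mk' X.kernel

theorem can_surjective (X : PositiveSubset Λ) : Function.Surjective X.can :=
  QuotientAddGroup.mk'_surjective X.kernel

theorem can_eq_can_iff (X : PositiveSubset Λ) {a b : Λ} :
    X.can a = X.can b ↔ -a + b ∈ X.kernel :=
  QuotientAddGroup.eq

theorem mem_of_can_eq (X : PositiveSubset Λ) {a b : Λ} (h : X.can a = X.can b)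
    (ha : a ∈ X.carrier) : b ∈ X.carrier := by
  have := X.add_mem _ _ ha (X.can_eq_can_iff.1 h).1
  simpa using this

/-- `γ ≤ γ'` when some representative of `γ' - γ` belongs to `X`. -/
instance (X : PositiveSubset Λ) : LE X.ValueGroup :=
  ⟨fun γ γ' => ∃ a ∈ X.carrier, X.can a = γ' - γ⟩

theorem le_def (X : PositiveSubset Λ) (γ γ' : X.ValueGroup) :
    γ ≤ γ' ↔ ∃ a ∈ X.carrier, X.can a = γ' - γ := Iff.rfl

open Classical in
instance (X : PositiveSubset Λ) : LinearOrder X.ValueGroup where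
  le_refl γ := ⟨0, by simpa using X.mem_or_neg_mem 0, by simp⟩
  le_trans γ₁ γ₂ γ₃ := by
    rintro ⟨a, ha, ha'⟩ ⟨b, hb, hb'⟩
    exact ⟨a + b, X.add_mem _ _ ha hb, by rw [map_add, ha', hb']; abel⟩
  le_antisymm γ γ' := by
    rintro ⟨a, ha, ha'⟩ ⟨b, hb, hb'⟩
    have h : X.can (-a) = X.can b := by rw [map_neg, ha', hb', neg_sub]
    have hk : a ∈ X.kernel := ⟨ha, X.mem_of_can_eq h.symm hb⟩
    have h0 : X.can 0 = X.can a := X.can_eq_can_iff.2 (by simpa using hk)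
    rw [map_zero, ha'] at h0
    exact (sub_eq_zero.1 h0.symm).symm
  le_total γ γ' := by
    obtain ⟨a, ha⟩ := X.can_surjective (γ' - γ)
    rcases X.mem_or_neg_mem a with h | h
    · exact Or.inl ⟨a, h, ha⟩
    · exact Or.inr ⟨-a, h, by rw [map_neg, ha, neg_sub]⟩
  toDecidableLE := Classical.decRel _

instance (X : PositiveSubset Λ) : IsOrderedAddMonoid X.ValueGroup where
  add_le_add_left γ γ' h δ := by
    obtain ⟨a, ha, ha'⟩ := h
    exact ⟨a, ha, by rw [ha']; abel⟩

/-- The inverse image `σ^*(X) = σ⁻¹(X)` of a positive subset under a morphism. -/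
def comap {Λ' : Type*} [AddCommGroup Λ'] (σ : Λ →+ Λ') (X : PositiveSubset Λ') :
    PositiveSubset Λ where
  carrier := σ ⁻¹' X.carrier
  mem_or_neg_mem a := by simpa using X.mem_or_neg_mem (σ a)
  add_mem a b ha hb := by simpa using X.add_mem _ _ ha hb
  inter_neg_isSubgroup := ⟨X.kernel.comap σ, fun a => by simp [mem_kernel]⟩

end

end PositiveSubset

/-! ### Cells -/

/-- The three kinds of cells: left, right, two-sided. -/
inductive CellKind
  | L
  | R
  | LR

namespace CoxeterSystem

noncomputable section

open HeckeAlgebra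

variable {B W Γ : Type*} [Group W] {M : CoxeterMatrix B} (cs : CoxeterSystem M W)

section

variable [AddCommGroup Γ] [LinearOrder Γ] [IsOrderedAddMonoid Γ]

/-- The elementary relation `x ← y`: the element `C_x` occurs in `h C_y` (kind `L`), in `C_y h`
(kind `R`), or in one of them (kind `LR`), for some `h` in the Hecke algebra. -/
def cellStep (φ : cs.SBar → Γ) : CellKind → W → W → Prop
  | .L, x, y => ∃ h : HeckeAlgebra cs φ, (klBasis cs φ).repr (h * klElement cs φ y) x ≠ 0
  | .R, x, y => ∃ h : HeckeAlgebra cs φ, (klBasis cs φ).repr (klElement cs φ y * h) x ≠ 0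
  | .LR, x, y => ∃ h : HeckeAlgebra cs φ, (klBasis cs φ).repr (h * klElement cs φ y) x ≠ 0 ∨
      (klBasis cs φ).repr (klElement cs φ y * h) x ≠ 0

/-- The preorder `≤_?^φ`: the transitive closure of `x ← y`. -/
def cellLE (φ : cs.SBar → Γ) (k : CellKind) : W → W → Prop :=
  Relation.TransGen (cs.cellStep φ k)

/-- The equivalence relation `∼_?^φ`, whose classes are the cells. -/
def cellEquiv (φ : cs.SBar → Γ) (k : CellKind) (x y : W) : Prop :=
  cs.cellLE φ k x y ∧ cs.cellLE φ k y x

end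

/-- The canonical map `φ_X : S̄ → Γ_X` attached to a positive subset `X` of `ℤ[S̄]`. -/
def phiPos (X : PositiveSubset (cs.SBar →₀ ℤ)) : cs.SBar → X.ValueGroup :=
  fun η => X.can (Finsupp.single η 1)

/-- The relation `∼_?^X` attached to a positive subset `X` of `ℤ[S̄]`. -/
def cellEquivPos (X : PositiveSubset (cs.SBar →₀ ℤ)) (k : CellKind) : W → W → Prop :=
  cs.cellEquiv (cs.phiPos X) k

open Classical in
/-- The symmetry `τ_ω` of `ℤ[S̄]`: `ω ↦ -ω`, and `η ↦ η` for `η ≠ ω`. -/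
def tau (ω : cs.SBar) : (cs.SBar →₀ ℤ) →ₗ[ℤ] (cs.SBar →₀ ℤ) :=
  Finsupp.linearCombination ℤ fun η =>
    if η = ω then -Finsupp.single ω 1 else Finsupp.single η 1

/-- The induced map `τ_ω^*` on positive subsets. -/
def tauStar (ω : cs.SBar) (X : PositiveSubset (cs.SBar →₀ ℤ)) :
    PositiveSubset (cs.SBar →₀ ℤ) :=
  X.comap (cs.tau ω).toAddMonoidHom

end

end CoxeterSystem

/-! Replacing $T_s$ by $-T_s$ in $(T_s-e^{\gamma})(T_s+e^{-\gamma})=0$ gives the same relation with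
$\gamma$ replaced by $-\gamma$. The sign of the parameter on one class $\omega$ is therefore
immaterial up to a sign character $\varepsilon$ of $W$, equal to $-1$ on the simple reflections of
class $\omega$ and to $1$ on the others.

More generally, let $f:\Gamma\to\Gamma'$ be a strictly increasing morphism and suppose
$\varphi'=\sigma\cdot(f\circ\varphi)$ with signs $\sigma$ on $\bar S$. The semilinear map `twist`,
$e^\gamma T_w\mapsto\varepsilon(w)e^{f(\gamma)}T_w$, is multiplicative (`twist_mul`), commutes with
the bar involution (`twist_bar`) and preserves negative parts (`twist_mem_negPart`). By uniqueness
of the Kazhdan-Lusztig elements it sends $C_w$ to $\varepsilon(w)C'_w$ (`twist_klElement`), so it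
preserves supports in these bases, and every elementary relation $x\leftarrow_? y$ for $\varphi$
holds for $\varphi'$ (`cellStep_of_twist`).

For the proposition, $f:\Gamma_{\tau_\omega^*(X)}\to\Gamma_X$ is the morphism induced by
$\tau_\omega$ (`comapHom`, `comapHom_strictMono`). This yields one implication for every $X$; the
other follows because $\tau_\omega^*$ is an involution. -/

namespace CoxeterSystem

noncomputable section

variable {B W : Type*} [Group W] {M : CoxeterMatrix B}

/-! ### Sign characters -/

/-- Simple reflections joined by an odd bond are conjugate. -/
theorem isConj_simple_of_odd (cs : CoxeterSystem M W) {i j : B} (h : Odd (M i j)) :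
    IsConj (cs.simple i) (cs.simple j) := by
  obtain ⟨k, hk⟩ := h
  -- In a dihedral group a reflection inverts rotations. With $p=s_is_j$ and $m=2k+1$ this gives
  -- $p^k s_i p^{-k}=p^{2k}s_i$, and $p^{2k}s_is_j=p^m=1$ identifies the result with $s_j$.
  have hc : SemiconjBy (cs.simple i) (cs.simple i * cs.simple j)
      (cs.simple i * cs.simple j)⁻¹ := by
    simp [SemiconjBy, mul_assoc]
  have h1 := (hc.pow_right k).inv_right.eq
  have h2 := cs.simple_mul_simple_pow i j
  rw [hk, pow_succ, two_mul, pow_add] at h2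
  refine isConj_iff.2 ⟨(cs.simple i * cs.simple j) ^ k, ?_⟩
  rw [inv_pow, inv_inv] at h1
  rw [mul_assoc, h1, ← mul_assoc]
  refine (eq_inv_of_mul_eq_one_left ?_).trans (cs.inv_simple j)
  rw [mul_assoc, h2]

/-- An even power of a sign is $1$, which also covers the value $0$ coding an infinite bond. If the
bond is odd, both reflections lie in one class and the product of the two equal signs is already
$1$. -/
theorem isLiftable_sign (cs : CoxeterSystem M W) (σ : cs.SBar → ℤˣ) :
    M.IsLiftable fun i => σ (cs.toSBar i) := by
  intro i j
  rcases Nat.even_or_odd (M i j) with ⟨k, hk⟩ | h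
  · rw [hk, ← two_mul, pow_mul, Int.units_sq, one_pow]
  · have : cs.toSBar i = cs.toSBar j :=
      Quotient.sound (s := cs.simpleConj) (cs.isConj_simple_of_odd h)
    simp only [this, Int.units_mul_self, one_pow]

/-- The linear character of `W` with prescribed signs on the classes of simple reflections. -/
def signChar (cs : CoxeterSystem M W) (σ : cs.SBar → ℤˣ) : W →* ℤˣ :=
  cs.lift ⟨_, cs.isLiftable_sign σ⟩

theorem signChar_simple (cs : CoxeterSystem M W) (σ : cs.SBar → ℤˣ) (i : B) :
    cs.signChar σ (cs.simple i) = σ (cs.toSBar i) := by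
  simp [signChar]

theorem signChar_inv (cs : CoxeterSystem M W) (σ : cs.SBar → ℤˣ) (w : W) :
    cs.signChar σ w⁻¹ = cs.signChar σ w := by
  rw [map_inv, Int.units_inv_eq_self]

namespace HeckeAlgebra

/-! ### Change of coefficients -/

section MapCoeff

variable {Γ Γ' : Type*} [AddCommGroup Γ] [AddCommGroup Γ'] (f : Γ →+ Γ')

/-- The morphism of group rings induced by `f`. -/
def mapCoeff : AddMonoidAlgebra ℤ Γ →+* AddMonoidAlgebra ℤ Γ' :=
  AddMonoidAlgebra.mapDomainRingHom ℤ f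

theorem mapCoeff_single (γ : Γ) (n : ℤ) :
    mapCoeff f (AddMonoidAlgebra.single γ n) = AddMonoidAlgebra.single (f γ) n := by
  simp [mapCoeff]

theorem mapCoeff_barCoeff (a : AddMonoidAlgebra ℤ Γ) :
    mapCoeff f (barCoeff Γ a) = barCoeff Γ' (mapCoeff f a) := by
  induction a using AddMonoidAlgebra.induction_linear with
  | zero => simp
  | add a b ha hb => simp [ha, hb]
  | single γ n => rw [barCoeff_single, mapCoeff_single, mapCoeff_single, barCoeff_single, map_neg]

theorem mapCoeff_injective (hf : Function.Injective f) : Function.Injective (mapCoeff f) :=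
  AddMonoidAlgebra.mapDomain_injective hf

/-- Strictness matters: a merely monotone $f$ could send a negative exponent to $0$. -/
theorem mapCoeff_mem_negCoeff [LinearOrder Γ] [LinearOrder Γ'] (hf : StrictMono f)
    {a : AddMonoidAlgebra ℤ Γ} (ha : a ∈ negCoeff Γ) : mapCoeff f a ∈ negCoeff Γ' := by
  classical
  intro γ' hγ'
  have h : γ' ∈ (Finsupp.mapDomain f a.coeff).support := Finsupp.mem_support_iff.2 hγ'
  obtain ⟨γ, hγ, rfl⟩ := Finset.mem_image.1 (Finsupp.mapDomain_support h)
  rw [← map_zero f]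
  exact hf (ha γ (Finsupp.mem_support_iff.1 hγ))

end MapCoeff

/-! ### The twist of the Hecke algebra by a sign character -/

variable {cs : CoxeterSystem M W} {Γ Γ' : Type*} [AddCommGroup Γ] [AddCommGroup Γ']
  {φ : cs.SBar → Γ} {φ' : cs.SBar → Γ'}

variable (φ φ') in
/-- The semilinear map `T_w ↦ ε(w) T_w`, where `ε` is the character attached to `σ`. -/
def twist (f : Γ →+ Γ') (σ : cs.SBar → ℤˣ) :
    HeckeAlgebra cs φ →ₛₗ[mapCoeff f] HeckeAlgebra cs φ' where
  toFun h := ((basis cs φ).repr h).sum fun w a =>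
    mapCoeff f a • ((cs.signChar σ w : ℤ) • T cs φ' w)
  map_add' a b := by
    rw [map_add]
    refine Finsupp.sum_add_index' (fun w => ?_) fun w a b => ?_
    · rw [map_zero, zero_smul]
    · rw [map_add, add_smul]
  map_smul' r a := by
    rw [map_smul, Finsupp.sum_smul_index (fun w => by rw [map_zero, zero_smul]), Finsupp.smul_sum]
    simp only [map_mul, mul_smul]

variable (f : Γ →+ Γ') (σ : cs.SBar → ℤˣ)

theorem twist_T (w : W) :
    twist φ φ' f σ (T cs φ w) = (cs.signChar σ w : ℤ) • T cs φ' w := by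
  change ((basis cs φ).repr (T cs φ w)).sum
    (fun w a => mapCoeff f a • ((cs.signChar σ w : ℤ) • T cs φ' w)) = _
  rw [T, Module.Basis.repr_self, Finsupp.sum_single_index (by rw [map_zero, zero_smul]), map_one,
    one_smul]

theorem twist_one : twist φ φ' f σ 1 = 1 := by
  rw [one_def, twist_T, map_one, Units.val_one, one_smul, one_def]

/-- The twist is diagonal with respect to the standard bases, so negativity of coefficients can be
checked one coordinate at a time. -/
theorem repr_twist (h : HeckeAlgebra cs φ) (w : W) :
    (basis cs φ').repr (twist φ φ' f σ h) w =
      (cs.signChar σ w : ℤ) • mapCoeff f ((basis cs φ).repr h w) := by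
  classical
  change (basis cs φ').repr (Finsupp.sum _ _) w = _
  rw [Finsupp.sum, map_sum, Finsupp.finsetSum_apply, Finset.sum_eq_single w]
  · rw [map_smul, map_zsmul, Finsupp.smul_apply, Finsupp.smul_apply, repr_T, if_pos rfl,
      smul_comm, smul_eq_mul, mul_one]
  · intro y _ hy
    rw [map_smul, map_zsmul, Finsupp.smul_apply, Finsupp.smul_apply, repr_T, if_neg hy,
      smul_zero, smul_zero]
  · intro hw
    rw [Finsupp.notMem_support_iff.1 hw, map_zero, zero_smul, map_zero, Finsupp.zero_apply]

theorem twist_mem_negPart [LinearOrder Γ] [LinearOrder Γ'] {f : Γ →+ Γ'} (hf : StrictMono f)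
    {h : HeckeAlgebra cs φ} (hh : h ∈ negPart cs φ) : twist φ φ' f σ h ∈ negPart cs φ' := by
  intro w
  rw [repr_twist]
  exact zsmul_mem (mapCoeff_mem_negCoeff f hf (hh w)) _

variable {f σ}

/-- The scalar $e^\gamma-e^{-\gamma}$ is odd in $\gamma$, so a sign on the parameter comes out as a
factor. This is what makes the twist compatible with the quadratic relation. -/
theorem mapCoeff_xi (hφ : ∀ η, φ' η = (σ η : ℤ) • f (φ η)) (i : B) :
    mapCoeff f (xi cs φ i) = (σ (cs.toSBar i) : ℤ) • xi cs φ' i := by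
  rw [xi, xi, hφ, map_sub, mapCoeff_single, mapCoeff_single, map_neg]
  rcases Int.units_eq_one_or (σ (cs.toSBar i)) with h | h <;> simp [h]

/-- By semilinearity it suffices to compare both sides on each $T_w$, where the product with $T_s$
is explicit. -/
theorem twist_T_simple_mul (hφ : ∀ η, φ' η = (σ η : ℤ) • f (φ η)) (i : B)
    (h : HeckeAlgebra cs φ) : twist φ φ' f σ (T cs φ (cs.simple i) * h) =
      twist φ φ' f σ (T cs φ (cs.simple i)) * twist φ φ' f σ h := by
  have key : (twist φ φ' f σ).comp
        (LinearMap.mulLeft (AddMonoidAlgebra ℤ Γ) (T cs φ (cs.simple i))) =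
      (LinearMap.mulLeft (AddMonoidAlgebra ℤ Γ') (twist φ φ' f σ (T cs φ (cs.simple i)))).comp
        (twist φ φ' f σ) := by
    refine (basis cs φ).ext fun w => ?_
    change twist φ φ' f σ (T cs φ (cs.simple i) * T cs φ w) =
      twist φ φ' f σ (T cs φ (cs.simple i)) * twist φ φ' f σ (T cs φ w)
    have e : twist φ φ' f σ (T cs φ (cs.simple i * w)) =
        ((σ (cs.toSBar i) : ℤ) * (cs.signChar σ w : ℤ)) • T cs φ' (cs.simple i * w) := by
      rw [twist_T, map_mul, signChar_simple, Units.val_mul]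
    rw [twist_T _ _ (cs.simple i), signChar_simple, twist_T _ _ w, smul_mul_smul_comm]
    by_cases hd : cs.IsLeftDescent w i
    -- Both terms must carry the sign $\sigma(s)\varepsilon(w)$. For $T_{sw}$ this is
    -- $\varepsilon(sw)$; for $\xi_sT_w$ the factor $\varepsilon(w)$ comes from $T_w$ and the
    -- missing $\sigma(s)$ from `mapCoeff_xi`.
    · rw [T_simple_mul_of_descent hd, T_simple_mul_of_descent hd, map_add,
        LinearMap.map_smulₛₗ, mapCoeff_xi hφ, e, twist_T, smul_add, smul_assoc,
        smul_comm (xi cs φ' i), smul_smul]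
    · rw [T_simple_mul_of_not_descent hd, T_simple_mul_of_not_descent hd, e]
  exact LinearMap.congr_fun key h

/-- Along a reduced word $T_w$ is the product of its $T_s$, so the case of one simple reflection
propagates by peeling off the first letter. -/
theorem twist_T_mul (hφ : ∀ η, φ' η = (σ η : ℤ) • f (φ η)) (w : W) (h : HeckeAlgebra cs φ) :
    twist φ φ' f σ (T cs φ w * h) = twist φ φ' f σ (T cs φ w) * twist φ φ' f σ h := by
  obtain ⟨l, hl, rfl⟩ := cs.exists_isReduced w
  induction l with
  | nil => rw [wordProd_nil, ← one_def, one_mul, twist_one, one_mul]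
  | cons i l ih =>
    have hl' : cs.IsReduced l := by simpa using hl.drop 1
    rw [wordProd_cons, ← T_simple_mul_of_not_descent, mul_assoc, twist_T_simple_mul hφ, ih hl',
      twist_T_simple_mul hφ, mul_assoc]
    rw [IsLeftDescent, ← wordProd_cons, hl.eq, hl'.eq]
    simp

theorem twist_mul (hφ : ∀ η, φ' η = (σ η : ℤ) • f (φ η)) (a b : HeckeAlgebra cs φ) :
    twist φ φ' f σ (a * b) = twist φ φ' f σ a * twist φ φ' f σ b := by
  have key : (twist φ φ' f σ).comp (LinearMap.mulRight (AddMonoidAlgebra ℤ Γ) b) =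
      (LinearMap.mulRight (AddMonoidAlgebra ℤ Γ') (twist φ φ' f σ b)).comp (twist φ φ' f σ) :=
    (basis cs φ).ext fun w => twist_T_mul hφ w b
  exact LinearMap.congr_fun key a

theorem twist_inverse (hφ : ∀ η, φ' η = (σ η : ℤ) • f (φ η)) {a : HeckeAlgebra cs φ}
    (ha : IsUnit a) : twist φ φ' f σ (Ring.inverse a) = Ring.inverse (twist φ φ' f σ a) := by
  symm
  refine Ring.inverse_unit (⟨_, _, ?_, ?_⟩ : (HeckeAlgebra cs φ')ˣ)
  · rw [← twist_mul hφ, Ring.mul_inverse_cancel _ ha, twist_one]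
  · rw [← twist_mul hφ, Ring.inverse_mul_cancel _ ha, twist_one]

/-- On $T_w$ this says that a multiplicative map respects inverses, together with
$\varepsilon(w^{-1})=\varepsilon(w)$ and the fact that a sign is its own inverse. -/
theorem twist_bar (hφ : ∀ η, φ' η = (σ η : ℤ) • f (φ η)) (h : HeckeAlgebra cs φ) :
    twist φ φ' f σ (bar cs φ h) = bar cs φ' (twist φ φ' f σ h) := by
  have hT : ∀ w, twist φ φ' f σ (bar cs φ (T cs φ w)) =
      bar cs φ' (twist φ φ' f σ (T cs φ w)) := by
    intro w
    rw [bar_T, twist_inverse hφ (isUnit_T _), twist_T, twist_T, signChar_inv, map_zsmul, bar_T]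
    obtain ⟨u, hu⟩ := isUnit_T (φ := φ') w⁻¹
    rcases Int.units_eq_one_or (cs.signChar σ w) with h | h
    · simp [h]
    · rw [h, Units.val_neg, Units.val_one, neg_one_zsmul, neg_one_zsmul, ← hu, ← Units.val_neg,
        Ring.inverse_unit, Ring.inverse_unit, show (-u)⁻¹ = -u⁻¹ from inv_eq_of_mul_eq_one_right (by simp),
        Units.val_neg]
  -- The two composites are semilinear over the two composites of `mapCoeff f` with `barCoeff`;
  -- these agree by `mapCoeff_barCoeff`, so the identity extends from the $T_w$ to all of the
  -- algebra.
  rw [← (basis cs φ).linearCombination_repr h, Finsupp.linearCombination_apply, Finsupp.sum]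
  simp only [map_sum, LinearMap.map_smulₛₗ, mapCoeff_barCoeff]
  exact Finset.sum_congr rfl fun w _ => by rw [← T, hT]

/-! ### Cells and twists -/

variable [LinearOrder Γ] [LinearOrder Γ'] [IsOrderedAddMonoid Γ] [IsOrderedAddMonoid Γ']

/-- The twisted element is bar-invariant and congruent to $\varepsilon(w)T_w$ modulo the negative
part. Multiplying by $\varepsilon(w)$ restores the leading term $T_w$, and uniqueness applies. -/
theorem twist_klElement (hf : StrictMono f) (hφ : ∀ η, φ' η = (σ η : ℤ) • f (φ η)) (w : W) :
    twist φ φ' f σ (klElement cs φ w) = (cs.signChar σ w : ℤ) • klElement cs φ' w := by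
  have hKL := klElement_isKL (φ := φ) w
  have hs : (cs.signChar σ w : ℤ) * (cs.signChar σ w : ℤ) = 1 := by
    rw [← Units.val_mul, Int.units_mul_self, Units.val_one]
  have h : IsKL w ((cs.signChar σ w : ℤ) • twist φ φ' f σ (klElement cs φ w)) := by
    refine ⟨by rw [map_zsmul, ← twist_bar hφ, hKL.1], ?_⟩
    have hn := zsmul_mem (twist_mem_negPart (φ' := φ') σ hf hKL.2) (cs.signChar σ w : ℤ)
    rwa [map_sub, twist_T, smul_sub, smul_smul, hs, one_smul] at hn
  rw [← h.unique (klElement_isKL w), smul_smul, hs, one_smul]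

theorem klBasis_repr_twist (hf : StrictMono f) (hφ : ∀ η, φ' η = (σ η : ℤ) • f (φ η))
    (h : HeckeAlgebra cs φ) (x : W) : (klBasis cs φ').repr (twist φ φ' f σ h) x =
      (cs.signChar σ x : ℤ) • mapCoeff f ((klBasis cs φ).repr h x) := by
  classical
  conv_lhs => rw [← (klBasis cs φ).linearCombination_repr h]
  rw [Finsupp.linearCombination_apply, Finsupp.sum, map_sum, map_sum, Finsupp.finsetSum_apply]
  have hy : ∀ (r : AddMonoidAlgebra ℤ Γ) (y : W),
      (klBasis cs φ').repr (twist φ φ' f σ (r • klBasis cs φ y)) x =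
        if y = x then (cs.signChar σ x : ℤ) • mapCoeff f r else 0 := by
    intro r y
    rw [LinearMap.map_smulₛₗ, klBasis_apply, twist_klElement hf hφ, ← klBasis_apply, map_smul,
      map_zsmul, Module.Basis.repr_self, Finsupp.smul_apply, Finsupp.smul_apply,
      Finsupp.single_apply]
    split_ifs with hyx
    · rw [hyx, smul_comm, smul_eq_mul, mul_one]
    · rw [smul_zero, smul_zero]
  rw [Finset.sum_congr rfl fun y _ => hy _ y, Finset.sum_ite_eq']
  split_ifs with hx
  · rfl
  · rw [Finsupp.notMem_support_iff.1 hx, map_zero, smul_zero]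

/-- Coefficients change only by a sign and by the injective map `mapCoeff f`. -/
theorem klBasis_repr_twist_ne_zero (hf : StrictMono f)
    (hφ : ∀ η, φ' η = (σ η : ℤ) • f (φ η)) {h : HeckeAlgebra cs φ} {x : W}
    (hx : (klBasis cs φ).repr h x ≠ 0) : (klBasis cs φ').repr (twist φ φ' f σ h) x ≠ 0 := by
  rw [klBasis_repr_twist hf hφ]
  have h0 := (map_ne_zero_iff _ (mapCoeff_injective f hf.injective)).2 hx
  rcases Int.units_eq_one_or (cs.signChar σ x) with h | h <;> simpa [h] using h0

end HeckeAlgebra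

open HeckeAlgebra

variable {Γ Γ' : Type*} [AddCommGroup Γ] [AddCommGroup Γ'] [LinearOrder Γ] [LinearOrder Γ']
  [IsOrderedAddMonoid Γ] [IsOrderedAddMonoid Γ']

/-- A witness $h$ is transported through the twist. Only this direction is available here, since $f$
need not be surjective and elements of the target algebra need not be twists. -/
theorem cellStep_of_twist (cs : CoxeterSystem M W) {f : Γ →+ Γ'} {σ : cs.SBar → ℤˣ}
    {φ : cs.SBar → Γ} {φ' : cs.SBar → Γ'} (hf : StrictMono f)
    (hφ : ∀ η, φ' η = (σ η : ℤ) • f (φ η)) (k : CellKind) {x y : W}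
    (h : cs.cellStep φ k x y) : cs.cellStep φ' k x y := by
  have hy : klElement cs φ' y =
      twist φ φ' f σ ((cs.signChar σ y : ℤ) • klElement cs φ y) := by
    rw [map_zsmul, twist_klElement hf hφ, smul_smul, ← Units.val_mul, Int.units_mul_self,
      Units.val_one, one_smul]
  have hs : (cs.signChar σ y : ℤ) * (cs.signChar σ y : ℤ) = 1 := by
    rw [← Units.val_mul, Int.units_mul_self, Units.val_one]
  -- The factor $\varepsilon(y)$ put on the witness cancels the one in `hy`, so the new product is
  -- exactly the twist of the old one.
  have left : ∀ a : HeckeAlgebra cs φ, (klBasis cs φ).repr (a * klElement cs φ y) x ≠ 0 →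
      (klBasis cs φ').repr (twist φ φ' f σ ((cs.signChar σ y : ℤ) • a) * klElement cs φ' y) x
        ≠ 0 := by
    intro a ha
    rw [hy, ← twist_mul hφ, smul_mul_smul_comm, hs, one_smul]
    exact klBasis_repr_twist_ne_zero hf hφ ha
  have right : ∀ a : HeckeAlgebra cs φ, (klBasis cs φ).repr (klElement cs φ y * a) x ≠ 0 →
      (klBasis cs φ').repr (klElement cs φ' y * twist φ φ' f σ ((cs.signChar σ y : ℤ) • a)) x
        ≠ 0 := by
    intro a ha
    rw [hy, ← twist_mul hφ, smul_mul_smul_comm, hs, one_smul]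
    exact klBasis_repr_twist_ne_zero hf hφ ha
  match k, h with
  | .L, ⟨a, ha⟩ => exact ⟨_, left a ha⟩
  | .R, ⟨a, ha⟩ => exact ⟨_, right a ha⟩
  | .LR, ⟨a, ha⟩ => exact ⟨_, ha.imp (left a) (right a)⟩

end

end CoxeterSystem

/-! ### Pullback of positive subsets and the induced map of ordered groups -/

namespace PositiveSubset

noncomputable section

variable {Λ Λ' : Type*} [AddCommGroup Λ] [AddCommGroup Λ'] (σ : Λ →+ Λ') (X : PositiveSubset Λ')

/-- The morphism `Γ_{σ^*(X)} → Γ_X` induced by `σ`. -/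
def comapHom : (X.comap σ).ValueGroup →+ X.ValueGroup :=
  QuotientAddGroup.map _ _ σ fun a ha => ⟨ha.1, by rw [← map_neg]; exact ha.2⟩

theorem comapHom_can (a : Λ) : comapHom σ X ((X.comap σ).can a) = X.can (σ a) := rfl

/-- The positive set of the source is by definition the preimage of $X$, which gives monotonicity;
its kernel is then the full preimage of $X\cap(-X)$, which gives injectivity even when $\sigma$ is
not injective. -/
theorem comapHom_strictMono : StrictMono (comapHom σ X) := by
  refine Monotone.strictMono_of_injective ?_ ?_
  · rintro γ γ' ⟨a, ha, h⟩
    exact ⟨σ a, ha, by rw [← comapHom_can, h, map_sub]⟩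
  · rw [injective_iff_map_eq_zero]
    intro γ h
    obtain ⟨a, rfl⟩ := (X.comap σ).can_surjective γ
    rw [comapHom_can, ← map_zero X.can, eq_comm, can_eq_can_iff, neg_zero, zero_add] at h
    rw [← map_zero (X.comap σ).can, eq_comm, can_eq_can_iff, neg_zero, zero_add]
    exact ⟨h.1, by
      change σ (-a) ∈ X.carrier
      rw [map_neg]; exact h.2⟩

end

end PositiveSubset

/-! ### The symmetry $\tau_\omega$ and invariance of cells -/

namespace CoxeterSystem

variable {B W : Type*} [Group W] {M : CoxeterMatrix B} (cs : CoxeterSystem M W) (ω : cs.SBar)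

open Classical in
-- Both branches of $\tau_\omega$ are written as one sign in `ℤˣ`, the shape of the $\sigma$ that
-- the twist takes.
theorem tau_single (η : cs.SBar) : cs.tau ω (Finsupp.single η 1) =
    ((if η = ω then -1 else 1 : ℤˣ) : ℤ) • Finsupp.single η 1 := by
  rw [tau, Finsupp.linearCombination_single, one_smul]
  split_ifs with h <;> simp [h]

theorem tau_tau (a : cs.SBar →₀ ℤ) : cs.tau ω (cs.tau ω a) = a := by
  have h : cs.tau ω ∘ₗ cs.tau ω = LinearMap.id := by
    refine Finsupp.lhom_ext' fun η => LinearMap.ext_ring ?_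
    change cs.tau ω (cs.tau ω (Finsupp.single η 1)) = Finsupp.single η 1
    rw [tau_single, map_zsmul, tau_single, smul_smul, ← Units.val_mul, Int.units_mul_self,
      Units.val_one, one_smul]
  exact LinearMap.congr_fun h a

theorem tauStar_tauStar (X : PositiveSubset (cs.SBar →₀ ℤ)) :
    cs.tauStar ω (cs.tauStar ω X) = X := by
  ext a
  change cs.tau ω (cs.tau ω a) ∈ X.carrier ↔ _
  rw [tau_tau]

theorem cellEquivPos_of_tauStar (X : PositiveSubset (cs.SBar →₀ ℤ)) (k : CellKind) {x y : W}
    (h : cs.cellEquivPos (cs.tauStar ω X) k x y) : cs.cellEquivPos X k x y := by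
  classical
  -- The induced morphism sends $\varphi_{\tau_\omega^*(X)}(\eta)$ to the class of
  -- $\tau_\omega(\eta)$, that is, to $\varphi_X(\eta)$ times its sign; the outer sign cancels it.
  have hφ : ∀ η, cs.phiPos X η = ((if η = ω then -1 else 1 : ℤˣ) : ℤ) •
      X.comapHom (cs.tau ω).toAddMonoidHom (cs.phiPos (cs.tauStar ω X) η) := by
    intro η
    change X.can _ = _ • X.can (cs.tau ω (Finsupp.single η 1))
    rw [tau_single, map_zsmul, smul_smul, ← Units.val_mul, Int.units_mul_self, Units.val_one,
      one_smul]
  have hstep : ∀ a b, cs.cellStep (cs.phiPos (cs.tauStar ω X)) k a b →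
      cs.cellStep (cs.phiPos X) k a b := fun a b =>
    cs.cellStep_of_twist (X.comapHom_strictMono (cs.tau ω).toAddMonoidHom) hφ k
  exact ⟨Relation.TransGen.mono hstep _ _ h.1, Relation.TransGen.mono hstep _ _ h.2⟩

end CoxeterSystem

theorem mainTheorem8 {B W : Type*} [Finite B] [Group W] {M : CoxeterMatrix B}
    (cs : CoxeterSystem M W) (ω : cs.SBar) (X : PositiveSubset (cs.SBar →₀ ℤ)) (k : CellKind)
    (x y : W) :
    cs.cellEquivPos X k x y ↔ cs.cellEquivPos (cs.tauStar ω X) k x y := by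
  refine ⟨fun h => ?_, cs.cellEquivPos_of_tauStar ω X k⟩
  -- The hypothesis now concerns the pullback of $\tau_\omega^*(X)$, so the implication already
  -- proved applies with $\tau_\omega^*(X)$ in place of $X$.
  rw [← cs.tauStar_tauStar ω X] at h
  exact cs.cellEquivPos_of_tauStar ω _ k h
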